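/- Let $d\in\mathbb N$, $\sigma_0\in\mathbb R$, and let $\tilde\omega_0,\tilde\tau_c,\xi,\epsilon>0$. Put $B(k)=1+\xi k$, $A(k)=e^{-\epsilon k}B(k)$ for $k\ge 0$, and consider the radial spectral density $$\widetilde C(k,\omega)=\frac{\sigma_0^2\,A(k)}{\omega^2+\left[\omega^2-\tilde\omega_0^2B(k)^2\right]^2\,\tilde\tau_c^2/B(k)^2},\qquad k\ge 0,\ \omega\in\mathbb R .$$ Assume $\tilde\omega_0\tilde\tau_c>1/2$, and set $c_0=\dfrac{\sigma_0^2}{2\tilde\tau_c\tilde\omega_0^2}$ and $\tilde\omega_d=\dfrac{1}{2\tilde\tau_c}\sqrt{4\tilde\tau_c^2\tilde\omega_0^2-1}$. Then $(\mathbf k,\omega)\mapsto\widetilde C(\|\mathbf k\|,\omega)$ is integrable on $\mathbb R^d\times\mathbb R$, and the kernel that it generates, $$C(\mathbf r,\tau)=\frac1{(2\pi)^{d+1}}\int_{\mathbb R^d}\int_{\mathbb R}e^{i(\mathbf k\cdot\mathbf r+\omega\tau)}\,\widetilde C(\|\mathbf k\|,\omega)\,d\omega\,d\mathbf k ,$$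 is given for all $\mathbf r\in\mathbb R^d$ and $\tau\in\mathbb R$, with $r=\|\mathbf r\|$, by $$C(\mathbf r,\tau)=c_0\,e^{-|\tau|/(2\tilde\tau_c)}\left[F_1(r,\tau)+F_2(r,\tau)\right],$$ $$F_1(r,\tau)=g_0(r,\tau)\cos\!\left(\tilde\omega_d|\tau|+\tfrac{(d+1)\gamma}{2}-\phi\right),\qquad F_2(r,\tau)=\frac{g_0(r,\tau)}{2\tilde\omega_d\tilde\tau_c}\sin\!\left(\tilde\omega_d|\tau|+\tfrac{(d+1)\gamma}{2}-\phi\right),$$ where $$g_0(r,\tau)=\frac{\Gamma\!\left(\frac{d+1}2\right)}{\pi^{(d+1)/2}}\;\frac{\left(a_{\Re}^2+a_{\Im}^2\right)^{1/2}}{\left[\left(a_{\Re}^2+a_{\Im}^2+r^2\right)^2-4a_{\Im}^2r^2\right]^{(d+1)/4}},\qquad a_{\Re}=\frac{\xi|\tau|}{2\tilde\tau_c}+\epsilon,\qquad a_{\Im}=\xi|\tau|\,\tilde\omega_d ,$$ $\phi=\phi(\tau)=\arctan(a_{\Im}/a_{\Re})\in[0,\pi/2)$, so $\tan\phi=a_{\Im}/a_{\Re}$,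 and $\gamma=\gamma(r,\tau)\in[0,\pi)$ is the polar angle of the point $\left(a_{\Re}^2-a_{\Im}^2+r^2,\;2a_{\Im}a_{\Re}\right)$; that is, $$\tan\gamma=\frac{2a_{\Im}a_{\Re}}{a_{\Re}^2-a_{\Im}^2+r^2},$$ with $\gamma=\pi/2$ where the denominator vanishes. -/

import Mathlib

open MeasureTheory

noncomputable section

namespace LDHO

/-- Dispersion function `B(k) = 1 + ξ k`, linear in the wavenumber `k`. -/
def dispB (ξ k : ℝ) : ℝ := 1 + ξ * k

/-- Dispersion function `A(k) = exp(-ε k) B(k)`. -/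
def dispA (ξ ε k : ℝ) : ℝ := Real.exp (-(ε * k)) * dispB ξ k

/-- The radial space-time spectral density of the damped harmonic oscillator,
`σ₀² A(k) / (ω² + (ω² - ω₀² B(k)²)² τc² / B(k)²)`,
with the linear-`k` dispersion functions; here `ω₀`, `τc` stand for the constants with tildes. -/
def spectralDensity (σ₀ ω₀ τc ξ ε k ω : ℝ) : ℝ :=
  σ₀ ^ 2 * dispA ξ ε k /
    (ω ^ 2 + (ω ^ 2 - ω₀ ^ 2 * dispB ξ k ^ 2) ^ 2 * (τc ^ 2 / dispB ξ k ^ 2))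

/-- The space-time inverse Fourier transform
`(2π)^{-(d+1)} ∫_{ℝᵈ × ℝ} exp(i(k·r + ωτ)) S(k, ω) dk dω`. -/
def inverseFourier {d : ℕ} (S : EuclideanSpace ℝ (Fin d) → ℝ → ℝ)
    (r : EuclideanSpace ℝ (Fin d)) (τ : ℝ) : ℂ :=
  (1 / (2 * (Real.pi : ℂ)) ^ (d + 1)) *
    ∫ p : EuclideanSpace ℝ (Fin d) × ℝ,
      Complex.exp (Complex.I * ((inner ℝ p.1 r + p.2 * τ : ℝ) : ℂ)) * (S p.1 p.2 : ℂ)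

/-- The spatiotemporal kernel generated by the radial spectral density. -/
def kernel {d : ℕ} (σ₀ ω₀ τc ξ ε : ℝ) (r : EuclideanSpace ℝ (Fin d)) (τ : ℝ) : ℂ :=
  inverseFourier (fun k ω => spectralDensity σ₀ ω₀ τc ξ ε ‖k‖ ω) r τ

/-- The amplitude `c₀ = σ₀² / (2 τc ω₀²)`. -/
def c0 (σ₀ ω₀ τc : ℝ) : ℝ := σ₀ ^ 2 / (2 * τc * ω₀ ^ 2)

/-- The damped frequency `ω_d = |√(4 τc² ω₀² - 1)| / (2 τc)`. -/
def omegaD (ω₀ τc : ℝ) : ℝ := 1 / (2 * τc) * |Real.sqrt (4 * τc ^ 2 * ω₀ ^ 2 - 1)|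

/-- `a_Re = ξ|τ| / (2 τc) + ε`. -/
def aRe (τc ξ ε τ : ℝ) : ℝ := ξ * |τ| / (2 * τc) + ε

/-- `a_Im = ξ |τ| ω_d`. -/
def aIm (ω₀ τc ξ τ : ℝ) : ℝ := ξ * |τ| * omegaD ω₀ τc

/-- Numerator of `tan γ`, `2 a_Im a_Re`. -/
def gammaNum (ω₀ τc ξ ε τ : ℝ) : ℝ := 2 * aIm ω₀ τc ξ τ * aRe τc ξ ε τ

/-- Denominator of `tan γ`, `a_Re² - a_Im² + r²`. It can vanish or be negative. -/
def gammaDen (ω₀ τc ξ ε r τ : ℝ) : ℝ := aRe τc ξ ε τ ^ 2 - aIm ω₀ τc ξ τ ^ 2 + r ^ 2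

/-- The phase `γ(r, τ)`: the polar angle of the point with coordinates
`(a_Re² - a_Im² + r², 2 a_Im a_Re)` of the plane. -/
def gammaPhase (ω₀ τc ξ ε r τ : ℝ) : ℝ :=
  Complex.arg ⟨gammaDen ω₀ τc ξ ε r τ, gammaNum ω₀ τc ξ ε τ⟩

/-- The phase `φ(τ) = arctan (a_Im / a_Re)`. -/
def phiPhase (ω₀ τc ξ ε τ : ℝ) : ℝ := Real.arctan (aIm ω₀ τc ξ τ / aRe τc ξ ε τ)

/-- The power-law amplitude `g₀(r, τ)` in dimension `d`. -/
def g0 (d : ℕ) (ω₀ τc ξ ε r τ : ℝ) : ℝ :=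
  Real.Gamma (((d : ℝ) + 1) / 2) / Real.pi ^ (((d : ℝ) + 1) / 2) *
    (Real.sqrt (aRe τc ξ ε τ ^ 2 + aIm ω₀ τc ξ τ ^ 2) /
      ((aRe τc ξ ε τ ^ 2 + aIm ω₀ τc ξ τ ^ 2 + r ^ 2) ^ 2
        - 4 * aIm ω₀ τc ξ τ ^ 2 * r ^ 2) ^ (((d : ℝ) + 1) / 4))

/-- The total phase `ω_d |τ| + (d+1)γ/2 - φ`. -/
def totalPhase (d : ℕ) (ω₀ τc ξ ε r τ : ℝ) : ℝ :=
  omegaD ω₀ τc * |τ| + ((d : ℝ) + 1) * gammaPhase ω₀ τc ξ ε r τ / 2 - phiPhase ω₀ τc ξ ε τ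

def F1 (d : ℕ) (ω₀ τc ξ ε r τ : ℝ) : ℝ :=
  g0 d ω₀ τc ξ ε r τ * Real.cos (totalPhase d ω₀ τc ξ ε r τ)

def F2 (d : ℕ) (ω₀ τc ξ ε r τ : ℝ) : ℝ :=
  g0 d ω₀ τc ξ ε r τ / (2 * omegaD ω₀ τc * τc) * Real.sin (totalPhase d ω₀ τc ξ ε r τ)

end LDHO

end

/-!
The spectral density is a rational function of `ω` at each wavenumber `k`, and its
denominator factors over `ℂ` as a multiple of `(ω² + l² B(k)²) (ω² + l'² B(k)²)`, where
`l = 1 / (2 τc) - i ω_d` (`decayRate`) and its conjugate `l'` satisfy `l l' = ω₀²` and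
`l² + l'² = 1 / τc² - 2 ω₀²`. Partial fractions in `ω²` (`spectralDensity_eq_partialFractions`) therefore
write it as a multiple of a difference of two functions `1 / (ω² + m²)` with `Re m > 0`. Each of these
is inverted by Fourier inversion of the two-sided exponential (`integral_cexp_mul_inv_sq_add_sq`),
which gives `(π / m) exp(-m |τ|)`.

Because `B(k) = 1 + ξ k` is linear and `A(k) = exp(-ε k) B(k)`, the `ω`-integration gives,
up to constant factors, a temporal exponential `exp(-l |τ|)` times `exp(-a ‖k‖)` with the complex rate
`a = ε + ξ |τ| l = aRe - i aIm` (`spatialRate`), minus the complex conjugate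
(`integral_cexp_mul_spectralDensity`). At `τ = 0` this also yields integrability on the product space.

It remains to transform `exp(-a ‖k‖)` on `ℝᵈ`, with `Re a > 0`. The answer is the Poisson kernel,
`(2π)ᵈ Γ((d+1)/2) / π^((d+1)/2) * a / (a² + ‖r‖²)^((d+1)/2)`. For real `a` it follows from Fubini and
the subordination formula `∫₀^∞ exp(-v² - s²/(4v²)) dv = (√π / 2) exp(-s)`
(`integral_subordination`). Both sides are holomorphic in the right half-plane, where `a² + ‖r‖²`
stays off the branch cut of the principal power, so the identity theorem extends the formula to
complex `a` (`integral_cexp_inner_mul_exp_neg_norm`). In polar form `a` has argument `-φ` and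
`a² + r²` has argument `-γ`, and the imaginary part of `l' exp(-l |τ|)` times the Poisson kernel is the
stated combination of a cosine and a sine.
-/

open MeasureTheory

noncomputable section

namespace LDHO

open Filter Topology Set ComplexConjugate

/-! ### Subordination of the exponential to Gaussians -/

lemma integrable_exp_neg_mul_norm {E : Type*} [NormedAddCommGroup E] [NormedSpace ℝ E]
    [FiniteDimensional ℝ E] [MeasurableSpace E] [BorelSpace E] (μ : Measure E)
    [μ.IsAddHaarMeasure] {c : ℝ} (hc : 0 < c) :
    Integrable (fun x : E => Real.exp (-(c * ‖x‖))) μ := by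
  -- Compare with `(1 + ‖x‖)⁻ⁿ`, integrable as soon as `n` exceeds the dimension.
  set n : ℕ := Module.finrank ℝ E + 1 with hn
  have h1 : Integrable (fun x : E => (1 + ‖x‖) ^ (-(n : ℝ))) μ :=
    integrable_one_add_norm (by rw [hn]; push_cast; linarith)
  refine (h1.const_mul (Real.exp c * n.factorial / c ^ n)).mono' (by fun_prop)
    (Eventually.of_forall fun x => ?_)
  have hx : 0 < 1 + ‖x‖ := by positivity
  have h2 := Real.pow_div_factorial_le_exp (x := c * (1 + ‖x‖)) (by positivity) n
  rw [Real.norm_of_nonneg (Real.exp_pos _).le, Real.rpow_neg hx.le, Real.rpow_natCast]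
  have h3 : Real.exp (-(c * ‖x‖)) = Real.exp c / Real.exp (c * (1 + ‖x‖)) := by
    rw [← Real.exp_sub]; congr 1; ring
  rw [h3]
  have h4 : 0 < (n.factorial : ℝ) := by positivity
  calc Real.exp c / Real.exp (c * (1 + ‖x‖))
      ≤ Real.exp c / ((c * (1 + ‖x‖)) ^ n / n.factorial) := by
        gcongr
    _ = _ := by
        rw [mul_pow]; field_simp

/-- The Gaussian primitive `∫₀ˣ exp(-w²) dw`, an unnormalised error function. -/
def gaussPrimitive (x : ℝ) : ℝ := ∫ w in (0 : ℝ)..x, Real.exp (-w ^ 2)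

lemma hasDerivAt_gaussPrimitive (x : ℝ) :
    HasDerivAt gaussPrimitive (Real.exp (-x ^ 2)) x :=
  (Continuous.integral_hasStrictDerivAt (f := fun w : ℝ => Real.exp (-w ^ 2))
    (by fun_prop) 0 x).hasDerivAt

lemma gaussPrimitive_neg (x : ℝ) : gaussPrimitive (-x) = -gaussPrimitive x := by
  have h := intervalIntegral.integral_comp_neg (a := 0) (b := x) fun w : ℝ => Real.exp (-w ^ 2)
  simp only [even_two, Even.neg_pow, neg_zero] at h
  rw [gaussPrimitive, gaussPrimitive, h, ← intervalIntegral.integral_symm]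

lemma tendsto_gaussPrimitive_atTop :
    Tendsto gaussPrimitive atTop (𝓝 (Real.sqrt Real.pi / 2)) := by
  have hi : Integrable fun w : ℝ => Real.exp (-w ^ 2) := by
    simpa using integrable_exp_neg_mul_sq (b := 1) one_pos
  have hv : ∫ w in Ioi (0 : ℝ), Real.exp (-w ^ 2) = Real.sqrt Real.pi / 2 := by
    simpa using integral_gaussian_Ioi 1
  rw [← hv]
  exact intervalIntegral_tendsto_integral_Ioi 0 hi.integrableOn tendsto_id

lemma tendsto_gaussPrimitive_atBot :
    Tendsto gaussPrimitive atBot (𝓝 (-(Real.sqrt Real.pi / 2))) := by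
  have h := (tendsto_gaussPrimitive_atTop.comp tendsto_neg_atBot_atTop).neg
  refine h.congr fun x => ?_
  simp [gaussPrimitive_neg]

/-- A primitive in `v` of the subordination integrand: completing the square in two ways writes
`exp(-v² - s²/(4v²))` as `exp(-s) exp(-(v - s/(2v))²)` and as `exp(s) exp(-(v + s/(2v))²)`. -/
lemma hasDerivAt_subordination_primitive (s : ℝ) {v : ℝ} (hv : 0 < v) :
    HasDerivAt (fun v : ℝ => (Real.exp (-s) * gaussPrimitive (v - s / (2 * v))
        + Real.exp s * gaussPrimitive (v + s / (2 * v))) / 2)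
      (Real.exp (-v ^ 2 - s ^ 2 / (4 * v ^ 2))) v := by
  have hq : HasDerivAt (fun v : ℝ => s / (2 * v)) (-(s / (2 * v ^ 2))) v := by
    have h := ((hasDerivAt_id v).const_mul 2).inv (by simpa using hv.ne')
    have h := h.const_mul s
    refine (h.congr_deriv ?_).congr_of_eventuallyEq (Eventually.of_forall fun x => ?_)
    · simp; field_simp
    · simp [div_eq_mul_inv]
  have h1 := (hasDerivAt_gaussPrimitive (v - s / (2 * v))).comp v ((hasDerivAt_id v).sub hq)
  have h2 := (hasDerivAt_gaussPrimitive (v + s / (2 * v))).comp v ((hasDerivAt_id v).add hq)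
  have h := ((h1.const_mul (Real.exp (-s))).add (h2.const_mul (Real.exp s))).div_const 2
  refine h.congr_deriv ?_
  have e1 : Real.exp (-s) * Real.exp (-(v - s / (2 * v)) ^ 2)
      = Real.exp (-v ^ 2 - s ^ 2 / (4 * v ^ 2)) := by
    rw [← Real.exp_add]; congr 1; field_simp; ring
  have e2 : Real.exp s * Real.exp (-(v + s / (2 * v)) ^ 2)
      = Real.exp (-v ^ 2 - s ^ 2 / (4 * v ^ 2)) := by
    rw [← Real.exp_add]; congr 1; field_simp; ring
  rw [← mul_assoc, ← mul_assoc, e1, e2]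
  ring

lemma integral_subordination_aux {s : ℝ} (hs : 0 < s) :
    IntegrableOn (fun v : ℝ => Real.exp (-v ^ 2 - s ^ 2 / (4 * v ^ 2))) (Ioi 0) ∧
    ∫ v in Ioi (0 : ℝ), Real.exp (-v ^ 2 - s ^ 2 / (4 * v ^ 2))
      = Real.sqrt Real.pi / 2 * Real.exp (-s) := by
  set f : ℝ → ℝ := fun v : ℝ => (Real.exp (-s) * gaussPrimitive (v - s / (2 * v))
        + Real.exp s * gaussPrimitive (v + s / (2 * v))) / 2 with hf
  set l0 : ℝ := (Real.exp (-s) * (-(Real.sqrt Real.pi / 2))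
        + Real.exp s * (Real.sqrt Real.pi / 2)) / 2 with hl0
  set l1 : ℝ := (Real.exp (-s) * (Real.sqrt Real.pi / 2)
        + Real.exp s * (Real.sqrt Real.pi / 2)) / 2 with hl1
  have hinv0 : Tendsto (fun v : ℝ => s / (2 * v)) (𝓝[>] 0) atTop := by
    have := (tendsto_inv_nhdsGT_zero (𝕜 := ℝ)).const_mul_atTop (half_pos hs)
    refine this.congr fun v => ?_
    rw [div_eq_mul_inv, div_eq_mul_inv, mul_inv]; ring
  have hinv1 : Tendsto (fun v : ℝ => s / (2 * v)) atTop (𝓝 0) :=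
    tendsto_const_nhds.div_atTop (tendsto_id.const_mul_atTop two_pos)
  have hid0 : Tendsto (fun v : ℝ => v) (𝓝[>] 0) (𝓝 0) :=
    tendsto_nhdsWithin_of_tendsto_nhds tendsto_id
  have t0 : Tendsto f (𝓝[>] 0) (𝓝 l0) := by
    refine (((tendsto_gaussPrimitive_atBot.comp ?_).const_mul _).add
      ((tendsto_gaussPrimitive_atTop.comp ?_).const_mul _)).div_const 2
    · simp only [sub_eq_add_neg]
      exact hid0.add_atBot (tendsto_neg_atTop_atBot.comp hinv0)
    · exact hid0.add_atTop hinv0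
  have t1 : Tendsto f atTop (𝓝 l1) := by
    refine (((tendsto_gaussPrimitive_atTop.comp ?_).const_mul _).add
      ((tendsto_gaussPrimitive_atTop.comp ?_).const_mul _)).div_const 2
    · simp only [sub_eq_add_neg]
      exact tendsto_id.atTop_add hinv1.neg
    · exact tendsto_id.atTop_add hinv1
  -- At `0` the primitive takes a junk value (division by zero); the right limit replaces it.
  have hc : ContinuousWithinAt (Function.update f 0 l0) (Ici 0) 0 := by
    rw [continuousWithinAt_update_same, Ici_sdiff_left]
    exact t0
  have hd : ∀ v ∈ Ioi (0 : ℝ), HasDerivAt (Function.update f 0 l0)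
      (Real.exp (-v ^ 2 - s ^ 2 / (4 * v ^ 2))) v := by
    intro v hv
    refine (hasDerivAt_subordination_primitive s hv).congr_of_eventuallyEq ?_
    filter_upwards [isOpen_ne.mem_nhds (ne_of_gt hv)] with x hx
    rw [Function.update_of_ne hx]
  have hl : Tendsto (Function.update f 0 l0) atTop (𝓝 l1) := by
    refine t1.congr' ?_
    filter_upwards [eventually_gt_atTop 0] with x hx
    rw [Function.update_of_ne hx.ne']
  have hp : ∀ v ∈ Ioi (0 : ℝ), 0 ≤ Real.exp (-v ^ 2 - s ^ 2 / (4 * v ^ 2)) :=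
    fun _ _ => (Real.exp_pos _).le
  refine ⟨integrableOn_Ioi_deriv_of_nonneg hc hd hp hl, ?_⟩
  rw [integral_Ioi_of_hasDerivAt_of_nonneg hc hd hp hl, Function.update_self, hl0, hl1]
  ring

/-- Subordination of the exponential to the Gaussian. -/
lemma integral_subordination {s : ℝ} (hs : 0 ≤ s) :
    IntegrableOn (fun v : ℝ => Real.exp (-v ^ 2 - s ^ 2 / (4 * v ^ 2))) (Ioi 0) ∧
    ∫ v in Ioi (0 : ℝ), Real.exp (-v ^ 2 - s ^ 2 / (4 * v ^ 2))
      = Real.sqrt Real.pi / 2 * Real.exp (-s) := by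
  rcases hs.eq_or_lt with rfl | hs
  · refine ⟨?_, ?_⟩
    · simpa using (integrable_exp_neg_mul_sq (b := 1) one_pos).integrableOn (s := Ioi 0)
    · simpa using integral_gaussian_Ioi 1
  · exact integral_subordination_aux hs

/-! ### The Poisson kernel at a real rate -/

section PoissonKernel

variable {V : Type*} [NormedAddCommGroup V] [InnerProductSpace ℝ V] [FiniteDimensional ℝ V]
  [MeasurableSpace V] [BorelSpace V]

lemma norm_cexp_I_mul_ofReal (x : ℝ) : ‖Complex.exp (Complex.I * (x : ℂ))‖ = 1 := by
  rw [mul_comm]; exact Complex.norm_exp_ofReal_mul_I x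

lemma integrable_subordination_prod {a : ℝ} (ha : 0 < a) (r : V) :
    Integrable (fun p : V × ℝ => Complex.exp (Complex.I * (inner ℝ p.1 r : ℝ)) *
        ((Real.exp (-p.2 ^ 2 - (a * ‖p.1‖) ^ 2 / (4 * p.2 ^ 2)) : ℝ) : ℂ))
      (volume.prod (volume.restrict (Ioi 0))) := by
  have hm : AEStronglyMeasurable (fun p : V × ℝ => Complex.exp (Complex.I * (inner ℝ p.1 r : ℝ)) *
        ((Real.exp (-p.2 ^ 2 - (a * ‖p.1‖) ^ 2 / (4 * p.2 ^ 2)) : ℝ) : ℂ))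
      (volume.prod (volume.restrict (Ioi 0))) := by
    apply Measurable.aestronglyMeasurable
    fun_prop
  have hn : ∀ (k : V) (v : ℝ), ‖Complex.exp (Complex.I * (inner ℝ k r : ℝ)) *
        ((Real.exp (-v ^ 2 - (a * ‖k‖) ^ 2 / (4 * v ^ 2)) : ℝ) : ℂ)‖
      = Real.exp (-v ^ 2 - (a * ‖k‖) ^ 2 / (4 * v ^ 2)) := by
    intro k v
    rw [norm_mul, norm_cexp_I_mul_ofReal, one_mul, Complex.norm_of_nonneg (Real.exp_pos _).le]
  rw [integrable_prod_iff hm]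
  refine ⟨Eventually.of_forall fun k => ?_, ?_⟩
  · exact ((integral_subordination (s := a * ‖k‖) (by positivity)).1.ofReal
      (𝕜 := ℂ)).const_mul (Complex.exp (Complex.I * (inner ℝ k r : ℝ)))
  · simp only [hn]
    refine ((integrable_exp_neg_mul_norm (volume : Measure V) ha).const_mul
      (Real.sqrt Real.pi / 2)).congr (Eventually.of_forall fun k => ?_)
    exact (integral_subordination (s := a * ‖k‖) (by positivity)).2.symm

lemma integral_subordination_gaussian {a v : ℝ} (ha : 0 < a) (hv : 0 < v) (r : V) :
    ∫ k : V, Complex.exp (Complex.I * (inner ℝ k r : ℝ)) *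
        ((Real.exp (-v ^ 2 - (a * ‖k‖) ^ 2 / (4 * v ^ 2)) : ℝ) : ℂ)
      = (((2 * Real.sqrt Real.pi / a) ^ Module.finrank ℝ V * (v ^ (Module.finrank ℝ V : ℝ) *
          Real.exp (-((a ^ 2 + ‖r‖ ^ 2) / a ^ 2) * v ^ (2 : ℝ))) : ℝ) : ℂ) := by
  set n := Module.finrank ℝ V with hn
  set b : ℝ := a ^ 2 / (4 * v ^ 2) with hb
  have hb0 : 0 < b := by positivity
  have h := GaussianFourier.integral_cexp_neg_mul_sq_norm_add (V := V) (b := (b : ℂ))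
    (by simpa using hb0) Complex.I r
  have hpow : ((Real.pi : ℂ) / b) ^ ((n : ℂ) / 2)
      = (((2 * Real.sqrt Real.pi / a) ^ n * v ^ n : ℝ) : ℂ) := by
    have hbase : Real.pi / b = (2 * Real.sqrt Real.pi / a * v) ^ 2 := by
      rw [hb, mul_pow, div_pow, mul_pow, Real.sq_sqrt Real.pi_pos.le]
      field_simp
      norm_num
    rw [← mul_pow, ← Complex.ofReal_div, hbase,
      show (n : ℂ) / 2 = (((n : ℝ) / 2 : ℝ) : ℂ) by push_cast; rfl,
      ← Complex.ofReal_cpow (by positivity), ← Real.rpow_natCast _ 2,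
      ← Real.rpow_mul (by positivity), ← Real.rpow_natCast _ n]
    congr 2
    push_cast
    ring
  rw [← hn, hpow] at h
  have hI : ∀ k : V, Complex.exp (Complex.I * (inner ℝ k r : ℝ)) *
        ((Real.exp (-v ^ 2 - (a * ‖k‖) ^ 2 / (4 * v ^ 2)) : ℝ) : ℂ)
      = Complex.exp (-v ^ 2) * Complex.exp (-b * ‖k‖ ^ 2 + Complex.I * (inner ℝ r k : ℝ)) := by
    intro k
    rw [Complex.ofReal_exp, ← Complex.exp_add, ← Complex.exp_add, real_inner_comm, hb]
    congr 1
    push_cast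
    ring
  simp_rw [hI]
  rw [integral_const_mul, h, Real.rpow_natCast, Real.rpow_ofNat]
  push_cast
  rw [mul_left_comm, ← Complex.exp_add, mul_assoc]
  congr 3
  rw [hb, Complex.I_sq]
  push_cast
  have : (a : ℂ) ≠ 0 := by exact_mod_cast ha.ne'
  have : (v : ℂ) ≠ 0 := by exact_mod_cast hv.ne'
  field_simp
  ring

/-- The Fourier transform of `exp(-a‖k‖)` for real `a`, by subordination to Gaussians. -/
lemma integral_cexp_inner_mul_exp_neg_norm_real {a : ℝ} (ha : 0 < a) (r : V) :
    ∫ k : V, Complex.exp (Complex.I * (inner ℝ k r : ℝ)) * Complex.exp (-(a * ‖k‖))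
      = (((2 * Real.pi) ^ Module.finrank ℝ V *
          (Real.Gamma (((Module.finrank ℝ V : ℝ) + 1) / 2) /
            Real.pi ^ (((Module.finrank ℝ V : ℝ) + 1) / 2)) *
          (a / (a ^ 2 + ‖r‖ ^ 2) ^ (((Module.finrank ℝ V : ℝ) + 1) / 2)) : ℝ) : ℂ) := by
  have hswap := integral_integral_swap (f := fun (k : V) (v : ℝ) =>
    Complex.exp (Complex.I * (inner ℝ k r : ℝ)) *
      ((Real.exp (-v ^ 2 - (a * ‖k‖) ^ 2 / (4 * v ^ 2)) : ℝ) : ℂ))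
    (integrable_subordination_prod ha r)
  have hleft : ∀ k : V, ∫ v in Ioi (0 : ℝ), Complex.exp (Complex.I * (inner ℝ k r : ℝ)) *
        ((Real.exp (-v ^ 2 - (a * ‖k‖) ^ 2 / (4 * v ^ 2)) : ℝ) : ℂ)
      = (Real.sqrt Real.pi / 2 : ℝ) *
        (Complex.exp (Complex.I * (inner ℝ k r : ℝ)) * Complex.exp (-(a * ‖k‖))) := by
    intro k
    rw [integral_const_mul, integral_complex_ofReal,
      (integral_subordination (s := a * ‖k‖) (by positivity)).2]
    push_cast
    ring
  simp_rw [hleft] at hswap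
  rw [integral_const_mul, setIntegral_congr_fun measurableSet_Ioi
    (fun v hv => integral_subordination_gaussian ha hv r), integral_complex_ofReal,
    integral_const_mul, integral_rpow_mul_exp_neg_mul_rpow two_pos
      (lt_of_lt_of_le (by norm_num) (Nat.cast_nonneg _)) (by positivity)] at hswap
  set n := Module.finrank ℝ V with hn
  have hsp : 0 < Real.sqrt Real.pi := Real.sqrt_pos.2 Real.pi_pos
  have hs0 : ((Real.sqrt Real.pi / 2 : ℝ) : ℂ) ≠ 0 := by
    exact_mod_cast (half_pos hsp).ne'
  refine mul_left_cancel₀ hs0 (hswap.trans ?_)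
  rw [← Complex.ofReal_mul]
  congr 1
  have hbase : ((a ^ 2 + ‖r‖ ^ 2) / a ^ 2) ^ (-((n : ℝ) + 1) / 2)
      = a ^ (n + 1) / (a ^ 2 + ‖r‖ ^ 2) ^ (((n : ℝ) + 1) / 2) := by
    rw [neg_div, Real.rpow_neg (by positivity), Real.div_rpow (by positivity) (by positivity),
      inv_div]
    congr 1
    rw [← Real.rpow_natCast a 2, ← Real.rpow_mul ha.le, ← Real.rpow_natCast]
    congr 1
    push_cast
    ring
  have hpi : Real.pi ^ (((n : ℝ) + 1) / 2) = Real.sqrt Real.pi ^ (n + 1) := by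
    rw [Real.sqrt_eq_rpow, ← Real.rpow_natCast, ← Real.rpow_mul Real.pi_pos.le]
    congr 1
    push_cast
    ring
  rw [hbase, hpi]
  have hq : 0 < (a ^ 2 + ‖r‖ ^ 2) ^ (((n : ℝ) + 1) / 2) := by positivity
  have hpi2 : (2 * Real.pi) ^ n = (2 * Real.sqrt Real.pi) ^ n * Real.sqrt Real.pi ^ n := by
    rw [← mul_pow, mul_assoc, Real.mul_self_sqrt Real.pi_pos.le]
  rw [hpi2, div_pow]
  field_simp
  ring

end PoissonKernel

/-! ### The Poisson kernel at a complex rate -/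

lemma norm_cexp_inner_mul_exp_neg_norm {V : Type*} [NormedAddCommGroup V]
    [InnerProductSpace ℝ V] (a : ℂ) (k r : V) :
    ‖Complex.exp (Complex.I * (inner ℝ k r : ℝ)) * Complex.exp (-(a * ‖k‖))‖
      = Real.exp (-(a.re * ‖k‖)) := by
  rw [norm_mul, norm_cexp_I_mul_ofReal, one_mul, Complex.norm_exp]
  simp

section PoissonKernelComplex

variable {V : Type*} [NormedAddCommGroup V] [InnerProductSpace ℝ V] [FiniteDimensional ℝ V]
  [MeasurableSpace V] [BorelSpace V]

lemma integrable_cexp_inner_mul_exp_neg_norm {a : ℂ} (ha : 0 < a.re) (r : V) :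
    Integrable fun k : V =>
      Complex.exp (Complex.I * (inner ℝ k r : ℝ)) * Complex.exp (-(a * ‖k‖)) := by
  refine (integrable_exp_neg_mul_norm volume ha).mono'
    (by apply Continuous.aestronglyMeasurable; fun_prop) (Eventually.of_forall fun k => ?_)
  exact (norm_cexp_inner_mul_exp_neg_norm a k r).le

lemma differentiableOn_integral_cexp_inner_mul_exp_neg_norm (r : V) :
    DifferentiableOn ℂ (fun a : ℂ => ∫ k : V,
      Complex.exp (Complex.I * (inner ℝ k r : ℝ)) * Complex.exp (-(a * ‖k‖))) {a | 0 < a.re} := by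
  intro a₀ (ha₀ : 0 < a₀.re)
  -- On the half-plane `Re a > c` the integrand decays uniformly in `a`; half of that rate absorbs
  -- the factor `‖k‖` of the derivative.
  set c : ℝ := a₀.re / 2 with hc
  have hc0 : 0 < c := half_pos ha₀
  have hs : {a : ℂ | c < a.re} ∈ 𝓝 a₀ :=
    (isOpen_lt continuous_const Complex.continuous_re).mem_nhds (by
      change a₀.re / 2 < a₀.re; linarith)
  refine (hasDerivAt_integral_of_dominated_loc_of_deriv_le (μ := volume)
    (F := fun (a : ℂ) (k : V) =>
      Complex.exp (Complex.I * (inner ℝ k r : ℝ)) * Complex.exp (-(a * ‖k‖)))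
    (F' := fun (a : ℂ) (k : V) =>
      Complex.exp (Complex.I * (inner ℝ k r : ℝ)) * (Complex.exp (-(a * ‖k‖)) * (-‖k‖)))
    (bound := fun k => 2 / c * Real.exp (-(c / 2 * ‖k‖))) hs
    (Eventually.of_forall fun a => by apply Continuous.aestronglyMeasurable; fun_prop)
    (integrable_cexp_inner_mul_exp_neg_norm ha₀ r)
    (by apply Continuous.aestronglyMeasurable; fun_prop)
    (Eventually.of_forall fun k a ha => ?_)
    ((integrable_exp_neg_mul_norm volume (half_pos hc0)).const_mul _)
    (Eventually.of_forall fun k a _ => ?_)).2.differentiableAt.differentiableWithinAt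
  · rw [← mul_assoc, norm_mul, norm_cexp_inner_mul_exp_neg_norm, norm_neg, Complex.norm_real,
      norm_norm]
    have h1 : Real.exp (-(a.re * ‖k‖)) ≤ Real.exp (-(c * ‖k‖)) := by
      have := mul_le_mul_of_nonneg_right (le_of_lt (show c < a.re from ha)) (norm_nonneg k)
      gcongr
    have h2 : ‖k‖ ≤ 2 / c * Real.exp (c / 2 * ‖k‖) := by
      have := Real.add_one_le_exp (c / 2 * ‖k‖)
      rw [div_mul_eq_mul_div, le_div_iff₀ hc0]
      linarith
    calc Real.exp (-(a.re * ‖k‖)) * ‖k‖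
        ≤ Real.exp (-(c * ‖k‖)) * (2 / c * Real.exp (c / 2 * ‖k‖)) := by gcongr
      _ = 2 / c * Real.exp (-(c / 2 * ‖k‖)) := by
        rw [mul_left_comm, ← Real.exp_add]
        congr 2
        ring
  · have h := (((hasDerivAt_id a).mul_const (‖k‖ : ℂ)).neg.cexp).const_mul
      (Complex.exp (Complex.I * (inner ℝ k r : ℝ)))
    simpa using h

/-- Otherwise `a` would be a square root of a nonpositive real number, hence purely imaginary. -/
lemma sq_add_sq_mem_slitPlane {a : ℂ} (ha : 0 < a.re) (x : ℝ) :
    a ^ 2 + (x : ℂ) ^ 2 ∈ Complex.slitPlane := by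
  rw [Complex.mem_slitPlane_iff]
  by_contra! h
  obtain ⟨h1, h2⟩ := h
  have hre : (a ^ 2 + (x : ℂ) ^ 2).re = a.re ^ 2 - a.im ^ 2 + x ^ 2 := by
    simp [pow_two]
  have him : (a ^ 2 + (x : ℂ) ^ 2).im = 2 * a.re * a.im := by
    simp [pow_two]; ring
  rw [him] at h2
  rw [hre] at h1
  have : a.im = 0 := by
    rcases mul_eq_zero.1 h2 with h | h
    · linarith
    · exact h
  rw [this] at h1
  nlinarith [sq_nonneg x]

/-- The complex Poisson kernel: analytic continuation of the real identity in `a` to the right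
half-plane, where `a² + ‖r‖²` avoids the branch cut of the principal power. -/
theorem integral_cexp_inner_mul_exp_neg_norm {a : ℂ} (ha : 0 < a.re) (r : V) :
    ∫ k : V, Complex.exp (Complex.I * (inner ℝ k r : ℝ)) * Complex.exp (-(a * ‖k‖))
      = (((2 * Real.pi) ^ Module.finrank ℝ V *
          (Real.Gamma (((Module.finrank ℝ V : ℝ) + 1) / 2) /
            Real.pi ^ (((Module.finrank ℝ V : ℝ) + 1) / 2)) : ℝ) : ℂ) *
          (a / (a ^ 2 + (‖r‖ : ℂ) ^ 2) ^ (((Module.finrank ℝ V : ℂ) + 1) / 2)) := by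
  set n := Module.finrank ℝ V with hn
  have hopen : IsOpen {a : ℂ | 0 < a.re} := isOpen_lt continuous_const Complex.continuous_re
  have hL := (differentiableOn_integral_cexp_inner_mul_exp_neg_norm r).analyticOnNhd hopen
  have hR : DifferentiableOn ℂ (fun a : ℂ => (((2 * Real.pi) ^ n *
          (Real.Gamma (((n : ℝ) + 1) / 2) / Real.pi ^ (((n : ℝ) + 1) / 2)) : ℝ) : ℂ) *
          (a / (a ^ 2 + (‖r‖ : ℂ) ^ 2) ^ (((n : ℂ) + 1) / 2))) {a | 0 < a.re} := by
    intro z hz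
    have hsl := sq_add_sq_mem_slitPlane hz ‖r‖
    have h0 : (z ^ 2 + (‖r‖ : ℂ) ^ 2) ^ (((n : ℂ) + 1) / 2) ≠ 0 := by
      rw [Complex.cpow_def_of_ne_zero (Complex.slitPlane_ne_zero hsl)]
      exact Complex.exp_ne_zero _
    have hd : DifferentiableAt ℂ
        (fun a : ℂ => (a ^ 2 + (‖r‖ : ℂ) ^ 2) ^ (((n : ℂ) + 1) / 2)) z :=
      DifferentiableAt.cpow (by fun_prop) (by fun_prop) hsl
    exact ((differentiableAt_id.div hd h0).const_mul _).differentiableWithinAt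
  refine AnalyticOnNhd.eqOn_of_preconnected_of_frequently_eq hL (hR.analyticOnNhd hopen)
    (convex_halfSpace_re_gt 0).isPreconnected (z₀ := 1) (by simp) ?_ ha
  -- The positive reals accumulate at `1`.
  have hmap : Tendsto (fun x : ℝ => (x : ℂ)) (𝓝[≠] 1) (𝓝[≠] 1) := by
    refine tendsto_nhdsWithin_iff.2 ⟨?_, ?_⟩
    · exact tendsto_nhdsWithin_of_tendsto_nhds
        (by simpa using Complex.continuous_ofReal.tendsto 1)
    · filter_upwards [self_mem_nhdsWithin] with x hx
      simpa using hx
  refine hmap.frequently (Eventually.frequently ?_)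
  filter_upwards [mem_nhdsWithin_of_mem_nhds (Ioi_mem_nhds (zero_lt_one' ℝ))] with x hx
  have hx : 0 < x := hx
  rw [integral_cexp_inner_mul_exp_neg_norm_real hx r, ← hn]
  push_cast
  congr 2
  rw [Complex.ofReal_cpow (by positivity)]
  push_cast
  rfl

end PoissonKernelComplex

/-! ### The Fourier pair of the two-sided exponential and the Lorentzian -/

section Lorentzian

lemma sq_add_sq_ne_zero {m : ℂ} (hm : 0 < m.re) (w : ℝ) : (w : ℂ) ^ 2 + m ^ 2 ≠ 0 := by
  rw [add_comm]
  exact Complex.slitPlane_ne_zero (sq_add_sq_mem_slitPlane hm w)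

lemma integrable_inv_sq_add_sq {m : ℂ} (hm : 0 < m.re) :
    Integrable fun w : ℝ => ((w : ℂ) ^ 2 + m ^ 2)⁻¹ := by
  refine (integrable_inv_one_add_sq.const_mul (1 + (‖m‖ ^ 2 + 1) / m.re ^ 2)).mono'
    (by apply Measurable.aestronglyMeasurable; fun_prop) (Eventually.of_forall fun w => ?_)
  have hfac : (w : ℂ) ^ 2 + m ^ 2 = (m + Complex.I * w) * (m - Complex.I * w) := by
    ring_nf; rw [Complex.I_sq]; ring
  -- The lower bound `(Re m)²` controls small `w`, the bound `w² - ‖m‖²` large `w`.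
  have h1 : m.re ^ 2 ≤ ‖(w : ℂ) ^ 2 + m ^ 2‖ := by
    rw [hfac, norm_mul, pow_two]
    have e1 : m.re ≤ ‖m + Complex.I * w‖ := by
      simpa using Complex.re_le_norm (m + Complex.I * w)
    have e2 : m.re ≤ ‖m - Complex.I * w‖ := by
      simpa using Complex.re_le_norm (m - Complex.I * w)
    exact mul_le_mul e1 e2 hm.le (norm_nonneg _)
  have h2 : w ^ 2 ≤ ‖(w : ℂ) ^ 2 + m ^ 2‖ + ‖m‖ ^ 2 := by
    have := norm_sub_le ((w : ℂ) ^ 2 + m ^ 2) (m ^ 2)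
    simpa using this
  have h0 : 0 < ‖(w : ℂ) ^ 2 + m ^ 2‖ := norm_pos_iff.2 (sq_add_sq_ne_zero hm w)
  have hr : 0 < m.re ^ 2 := by positivity
  have h3 : ‖m‖ ^ 2 + 1 ≤ (‖m‖ ^ 2 + 1) / m.re ^ 2 * ‖(w : ℂ) ^ 2 + m ^ 2‖ := by
    rw [div_mul_eq_mul_div, le_div_iff₀ hr]
    gcongr
  rw [norm_inv, ← div_eq_mul_inv, inv_le_comm₀ h0 (by positivity), inv_div,
    div_le_iff₀ (by positivity)]
  linarith

lemma integrable_exp_neg_mul_abs {m : ℂ} (hm : 0 < m.re) :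
    Integrable fun t : ℝ => Complex.exp (-(m * |t|)) := by
  have := integrable_cexp_inner_mul_exp_neg_norm hm (0 : ℝ)
  simpa using this

/-- The Fourier transform of the two-sided exponential is a Lorentzian. -/
lemma integral_exp_neg_mul_abs {m : ℂ} (hm : 0 < m.re) (w : ℝ) :
    ∫ t : ℝ, Complex.exp (-(Complex.I * (w * t))) * Complex.exp (-(m * |t|))
      = 2 * m * ((w : ℂ) ^ 2 + m ^ 2)⁻¹ := by
  have hi : Integrable fun t : ℝ =>
      Complex.exp (-(Complex.I * (w * t))) * Complex.exp (-(m * |t|)) := by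
    have := integrable_cexp_inner_mul_exp_neg_norm hm (-w : ℝ)
    refine this.congr (Eventually.of_forall fun t => ?_)
    simp
  have e1 : ∫ t in Iic (0 : ℝ), Complex.exp (-(Complex.I * (w * t))) * Complex.exp (-(m * |t|))
      = 1 / (m - Complex.I * w) := by
    have h := integral_exp_mul_complex_Iic (a := m - Complex.I * w) (by simpa using hm) 0
    simp only [Complex.ofReal_zero, mul_zero, Complex.exp_zero] at h
    rw [← h]
    refine setIntegral_congr_fun measurableSet_Iic fun t ht => ?_
    rw [← Complex.exp_add, abs_of_nonpos ht]
    congr 1; push_cast; ring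
  have e2 : ∫ t in Ioi (0 : ℝ), Complex.exp (-(Complex.I * (w * t))) * Complex.exp (-(m * |t|))
      = 1 / (m + Complex.I * w) := by
    have h := integral_exp_mul_complex_Ioi (a := -(m + Complex.I * w)) (by simpa using hm) 0
    simp only [Complex.ofReal_zero, mul_zero, Complex.exp_zero, neg_div_neg_eq] at h
    rw [← h]
    refine setIntegral_congr_fun measurableSet_Ioi fun t ht => ?_
    rw [← Complex.exp_add, abs_of_pos ht]
    congr 1; ring
  have h1 : m - Complex.I * w ≠ 0 := fun h => by
    have := congrArg Complex.re h; simp at this; linarith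
  have h2 : m + Complex.I * w ≠ 0 := fun h => by
    have := congrArg Complex.re h; simp at this; linarith
  have hfac : (w : ℂ) ^ 2 + m ^ 2 = (m + Complex.I * w) * (m - Complex.I * w) := by
    ring_nf; rw [Complex.I_sq]; ring
  rw [← intervalIntegral.integral_Iic_add_Ioi hi.integrableOn hi.integrableOn, e1, e2, hfac]
  field_simp
  ring

/-- The inverse transform of the Lorentzian, by Fourier inversion. -/
theorem integral_cexp_mul_inv_sq_add_sq {m : ℂ} (hm : 0 < m.re) (t : ℝ) :
    ∫ w : ℝ, Complex.exp (Complex.I * (w * t)) * ((w : ℂ) ^ 2 + m ^ 2)⁻¹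
      = Real.pi / m * Complex.exp (-(m * |t|)) := by
  set f : ℝ → ℂ := fun t => Complex.exp (-(m * |t|)) with hf
  have hm0 : m ≠ 0 := fun h => by simp [h] at hm
  have hF : ∀ x : ℝ, FourierTransform.fourier f x
      = 2 * m * (((2 * Real.pi * x : ℝ) : ℂ) ^ 2 + m ^ 2)⁻¹ := by
    intro x
    rw [← integral_exp_neg_mul_abs hm, Real.fourier_real_eq_integral_exp_smul]
    refine integral_congr_ae (Eventually.of_forall fun v => ?_)
    simp only [smul_eq_mul, hf]
    congr 2
    push_cast; ring
  have h2pi : (2 * Real.pi) ≠ 0 := by positivity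
  have hFi : Integrable (FourierTransform.fourier f) := by
    rw [show FourierTransform.fourier f = _ from funext hF]
    exact ((integrable_inv_sq_add_sq hm).comp_mul_left' h2pi).const_mul _
  have hinv := congrFun (Continuous.fourierInv_fourier_eq (f := f) (by fun_prop)
    (integrable_exp_neg_mul_abs hm) hFi) t
  rw [Real.fourierInv_eq'] at hinv
  have hscale := Measure.integral_comp_mul_left
    (fun w : ℝ => Complex.exp (Complex.I * (w * t)) * ((w : ℂ) ^ 2 + m ^ 2)⁻¹) (2 * Real.pi)
  have hcongr : ∫ v : ℝ, Complex.exp (((2 * Real.pi * inner ℝ v t : ℝ) : ℂ) * Complex.I) •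
        FourierTransform.fourier f v
      = 2 * m * ∫ x : ℝ, Complex.exp (Complex.I * ((2 * Real.pi * x : ℝ) * t)) *
          (((2 * Real.pi * x : ℝ) : ℂ) ^ 2 + m ^ 2)⁻¹ := by
    rw [← integral_const_mul]
    refine integral_congr_ae (Eventually.of_forall fun v => ?_)
    simp only [hF, smul_eq_mul]
    rw [mul_left_comm]
    congr 3
    simp only [RCLike.inner_apply, conj_trivial]
    push_cast; ring
  rw [hcongr, hscale, abs_of_pos (by positivity), Complex.real_smul] at hinv
  change _ = Complex.exp (-(m * |t|)) at hinv
  rw [← hinv]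
  generalize (∫ w : ℝ, Complex.exp (Complex.I * (w * t)) * ((w : ℂ) ^ 2 + m ^ 2)⁻¹) = J
  have : (Real.pi : ℂ) ≠ 0 := by exact_mod_cast Real.pi_ne_zero
  push_cast
  field_simp

lemma integrable_cexp_mul_inv_sq_add_sq {m : ℂ} (hm : 0 < m.re) (t : ℝ) :
    Integrable fun w : ℝ => Complex.exp (Complex.I * (w * t)) * ((w : ℂ) ^ 2 + m ^ 2)⁻¹ := by
  refine (integrable_inv_sq_add_sq hm).norm.mono'
    (by apply Measurable.aestronglyMeasurable; fun_prop) (Eventually.of_forall fun w => ?_)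
  have := norm_cexp_I_mul_ofReal (w * t)
  push_cast at this
  rw [norm_mul, this, one_mul]

end Lorentzian

/-! ### Positivity of the parameters, and the two phases -/

section Parameters

variable {σ₀ ω₀ τc ξ ε : ℝ}

lemma omegaD_pos (hτc : 0 < τc) (hunder : 1 / 2 < ω₀ * τc) :
    0 < omegaD ω₀ τc := by
  have : 0 < 4 * τc ^ 2 * ω₀ ^ 2 - 1 := by nlinarith
  unfold omegaD
  have := Real.sqrt_pos.2 this
  positivity

lemma omegaD_sq (hτc : 0 < τc) (hunder : 1 / 2 < ω₀ * τc) :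
    omegaD ω₀ τc ^ 2 = ω₀ ^ 2 - (1 / (2 * τc)) ^ 2 := by
  have : 0 ≤ 4 * τc ^ 2 * ω₀ ^ 2 - 1 := by nlinarith
  rw [omegaD, mul_pow, sq_abs, Real.sq_sqrt this]
  field_simp
  ring

lemma dispB_pos (hξ : 0 < ξ) {k : ℝ} (hk : 0 ≤ k) : 0 < dispB ξ k := by
  unfold dispB; positivity

lemma aRe_pos (hτc : 0 < τc) (hξ : 0 < ξ) (hε : 0 < ε) (τ : ℝ) : 0 < aRe τc ξ ε τ := by
  unfold aRe; positivity

lemma aIm_nonneg (hτc : 0 < τc) (hξ : 0 < ξ) (τ : ℝ) : 0 ≤ aIm ω₀ τc ξ τ := by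
  unfold aIm omegaD; positivity

end Parameters

section Phases

variable {ω₀ τc ξ ε : ℝ}

lemma phiPhase_mem_and_tan (hτc : 0 < τc) (hξ : 0 < ξ) (hε : 0 < ε) (τ : ℝ) :
    phiPhase ω₀ τc ξ ε τ ∈ Ico 0 (Real.pi / 2) ∧
      Real.tan (phiPhase ω₀ τc ξ ε τ) = aIm ω₀ τc ξ τ / aRe τc ξ ε τ :=
  ⟨⟨Real.arctan_nonneg.2 (div_nonneg (aIm_nonneg hτc hξ τ) (aRe_pos hτc hξ hε τ).le),
    Real.arctan_lt_pi_div_two _⟩, Real.tan_arctan _⟩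

lemma gammaNum_nonneg (hτc : 0 < τc) (hξ : 0 < ξ) (hε : 0 < ε) (τ : ℝ) :
    0 ≤ gammaNum ω₀ τc ξ ε τ := by
  have := aIm_nonneg (ω₀ := ω₀) hτc hξ τ
  have := aRe_pos hτc hξ hε τ
  unfold gammaNum; positivity

lemma gammaDen_pos_of_gammaNum_eq_zero (hτc : 0 < τc) (hξ : 0 < ξ) (hε : 0 < ε) {r τ : ℝ}
    (h : gammaNum ω₀ τc ξ ε τ = 0) : 0 < gammaDen ω₀ τc ξ ε r τ := by
  have hR := aRe_pos hτc hξ hε τ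
  have hI : aIm ω₀ τc ξ τ = 0 := by
    simpa [gammaNum, hR.ne'] using h
  unfold gammaDen
  rw [hI, zero_pow two_ne_zero, sub_zero]
  positivity

lemma gammaPhase_mem_and_tan (hτc : 0 < τc) (hξ : 0 < ξ) (hε : 0 < ε) (r τ : ℝ) :
    gammaPhase ω₀ τc ξ ε r τ ∈ Ico 0 Real.pi ∧
      (gammaDen ω₀ τc ξ ε r τ ≠ 0 → Real.tan (gammaPhase ω₀ τc ξ ε r τ) =
        gammaNum ω₀ τc ξ ε τ / gammaDen ω₀ τc ξ ε r τ) ∧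
      (gammaDen ω₀ τc ξ ε r τ = 0 → gammaPhase ω₀ τc ξ ε r τ = Real.pi / 2) := by
  have hN := gammaNum_nonneg (ω₀ := ω₀) hτc hξ hε τ
  refine ⟨⟨Complex.arg_nonneg_iff.2 hN, lt_of_le_of_ne (Complex.arg_le_pi _) fun h => ?_⟩,
    fun _ => Complex.tan_arg _, fun h => ?_⟩
  · obtain ⟨h1, h2⟩ := Complex.arg_eq_pi_iff.1 h
    exact (gammaDen_pos_of_gammaNum_eq_zero hτc hξ hε h2).not_gt h1
  · refine Complex.arg_eq_pi_div_two_iff.2 ⟨h, lt_of_le_of_ne hN fun h' => ?_⟩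
    exact (gammaDen_pos_of_gammaNum_eq_zero (r := r) hτc hξ hε h'.symm).ne' h

end Phases

/-! ### The temporal transform of the spectral density -/

/-- The complex decay rate `1 / (2 τc) - i ω_d` of the damped oscillator. The poles of the spectral
density in `ω` are `± i B(k)` times this rate and its conjugate. -/
def decayRate (ω₀ τc : ℝ) : ℂ := ⟨1 / (2 * τc), -omegaD ω₀ τc⟩

section Oscillator

variable {σ₀ ω₀ τc ξ ε : ℝ}

lemma decayRate_re_pos (hτc : 0 < τc) : 0 < (decayRate ω₀ τc).re := by
  simp only [decayRate]; positivity

lemma decayRate_mul_conj (hτc : 0 < τc) (hunder : 1 / 2 < ω₀ * τc) :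
    decayRate ω₀ τc * conj (decayRate ω₀ τc) = (ω₀ : ℂ) ^ 2 := by
  rw [Complex.mul_conj, Complex.normSq_apply]
  simp only [decayRate]
  have := omegaD_sq hτc hunder
  norm_cast
  linarith

lemma decayRate_sq_add_conj_sq (hτc : 0 < τc) (hunder : 1 / 2 < ω₀ * τc) :
    decayRate ω₀ τc ^ 2 + conj (decayRate ω₀ τc) ^ 2 = 1 / (τc : ℂ) ^ 2 - 2 * (ω₀ : ℂ) ^ 2 := by
  rw [← map_pow, Complex.add_conj, pow_two]
  simp only [decayRate, Complex.mul_re]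
  have := omegaD_sq hτc hunder
  norm_cast
  have h2 : 1 / τc ^ 2 = 4 * (1 / (2 * τc)) ^ 2 := by field_simp; norm_num
  push_cast [h2]
  linarith

lemma conj_sq_sub_decayRate_sq (hτc : 0 < τc) :
    conj (decayRate ω₀ τc) ^ 2 - decayRate ω₀ τc ^ 2
      = 2 * Complex.I * omegaD ω₀ τc / (τc : ℂ) := by
  have : (τc : ℂ) ≠ 0 := by exact_mod_cast hτc.ne'
  have h1 : decayRate ω₀ τc = 1 / (2 * τc) - omegaD ω₀ τc * Complex.I := by
    apply Complex.ext <;> simp [decayRate]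
  rw [h1]
  simp only [map_sub, map_div₀, map_mul, map_one, map_ofNat, Complex.conj_ofReal, Complex.conj_I]
  field_simp
  ring

/-- Partial fractions in `ω²`. -/
lemma spectralDensity_eq_partialFractions (hτc : 0 < τc)
    (hξ : 0 < ξ) (hunder : 1 / 2 < ω₀ * τc) {k : ℝ} (hk : 0 ≤ k) (w : ℝ) :
    (spectralDensity σ₀ ω₀ τc ξ ε k w : ℂ)
      = σ₀ ^ 2 * Real.exp (-(ε * k)) * dispB ξ k / (2 * Complex.I * omegaD ω₀ τc * τc) *
        (((w : ℂ) ^ 2 + (decayRate ω₀ τc * dispB ξ k) ^ 2)⁻¹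
          - ((w : ℂ) ^ 2 + (conj (decayRate ω₀ τc) * dispB ξ k) ^ 2)⁻¹) := by
  have hB := dispB_pos hξ hk
  have hq := omegaD_pos hτc hunder
  have hX : (w : ℂ) ^ 2 + (decayRate ω₀ τc * dispB ξ k) ^ 2 ≠ 0 := by
    apply sq_add_sq_ne_zero
    rw [Complex.re_mul_ofReal]
    exact mul_pos (decayRate_re_pos hτc) hB
  have hY : (w : ℂ) ^ 2 + (conj (decayRate ω₀ τc) * dispB ξ k) ^ 2 ≠ 0 := by
    apply sq_add_sq_ne_zero
    rw [Complex.re_mul_ofReal, Complex.conj_re]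
    exact mul_pos (decayRate_re_pos hτc) hB
  have h1 := decayRate_mul_conj hτc hunder
  have h2 := decayRate_sq_add_conj_sq hτc hunder
  have h3 := conj_sq_sub_decayRate_sq (ω₀ := ω₀) hτc
  unfold spectralDensity dispA
  generalize dispB ξ k = B at *
  generalize omegaD ω₀ τc = q at *
  generalize decayRate ω₀ τc = l at *
  generalize conj l = m at *
  have hBc : (B : ℂ) ≠ 0 := by exact_mod_cast hB.ne'
  have hqc : (q : ℂ) ≠ 0 := by exact_mod_cast hq.ne'
  have hτcc : (τc : ℂ) ≠ 0 := by exact_mod_cast hτc.ne'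
  have hD : (w : ℂ) ^ 2 + ((w : ℂ) ^ 2 - (ω₀ : ℂ) ^ 2 * (B : ℂ) ^ 2) ^ 2 *
        ((τc : ℂ) ^ 2 / (B : ℂ) ^ 2)
      = (τc : ℂ) ^ 2 / (B : ℂ) ^ 2 *
        (((w : ℂ) ^ 2 + (l * B) ^ 2) * ((w : ℂ) ^ 2 + (m * B) ^ 2)) := by
    have hexp : ((w : ℂ) ^ 2 + (l * B) ^ 2) * ((w : ℂ) ^ 2 + (m * B) ^ 2)
        = w ^ 4 + (l ^ 2 + m ^ 2) * (w ^ 2 * B ^ 2) + (l * m) ^ 2 * B ^ 4 := by ring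
    rw [hexp, h1, h2]
    field_simp
    ring
  have hdiff : ((w : ℂ) ^ 2 + (l * B) ^ 2)⁻¹ - ((w : ℂ) ^ 2 + (m * B) ^ 2)⁻¹
      = 2 * Complex.I * q / τc * B ^ 2 /
        (((w : ℂ) ^ 2 + (l * B) ^ 2) * ((w : ℂ) ^ 2 + (m * B) ^ 2)) := by
    rw [← h3, inv_sub_inv hX hY]
    congr 1
    ring
  push_cast
  rw [hD, hdiff]
  field_simp

/-- The factor `σ₀² π / (2 i ω_d τc)` common to both summands of the temporal inverse transform of
the spectral density. -/
def residueConst (σ₀ ω₀ τc : ℝ) : ℂ :=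
  σ₀ ^ 2 * Real.pi / (2 * Complex.I * omegaD ω₀ τc * τc)

/-- The complex rate `a = aRe - i aIm` at which the summand with time decay `decayRate` falls off in
the wavenumber after the `ω`-integration. -/
def spatialRate (ω₀ τc ξ ε τ : ℝ) : ℂ := ⟨aRe τc ξ ε τ, -aIm ω₀ τc ξ τ⟩

lemma spatialRate_eq (τ : ℝ) :
    spatialRate ω₀ τc ξ ε τ = ε + ξ * |τ| * decayRate ω₀ τc := by
  apply Complex.ext
  · simp [spatialRate, decayRate, aRe, div_eq_mul_inv]; ring
  · simp [spatialRate, decayRate, aIm]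

lemma integrable_cexp_mul_spectralDensity (hτc : 0 < τc)
    (hξ : 0 < ξ) (hunder : 1 / 2 < ω₀ * τc) {k : ℝ} (hk : 0 ≤ k) (τ : ℝ) :
    Integrable fun w : ℝ => Complex.exp (Complex.I * (w * τ)) *
      (spectralDensity σ₀ ω₀ τc ξ ε k w : ℂ) := by
  have hB := dispB_pos hξ hk
  have h1 : 0 < (decayRate ω₀ τc * dispB ξ k).re := by
    rw [Complex.re_mul_ofReal]
    exact mul_pos (decayRate_re_pos hτc) hB
  have h2 : 0 < (conj (decayRate ω₀ τc) * dispB ξ k).re := by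
    rw [Complex.re_mul_ofReal, Complex.conj_re]
    exact mul_pos (decayRate_re_pos hτc) hB
  refine (((integrable_cexp_mul_inv_sq_add_sq h1 τ).sub
    (integrable_cexp_mul_inv_sq_add_sq h2 τ)).const_mul
      (σ₀ ^ 2 * Real.exp (-(ε * k)) * dispB ξ k / (2 * Complex.I * omegaD ω₀ τc * τc))).congr
    (Eventually.of_forall fun w => ?_)
  simp only [spectralDensity_eq_partialFractions hτc hξ hunder hk, Pi.sub_apply]
  ring

/-- The temporal inverse transform of the spectral density. Since `B(k) = 1 + ξ k`, the decay
`exp(-decayRate * B(k) |τ|)` factors into a temporal and a spatial exponential. -/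
lemma integral_cexp_mul_spectralDensity (hτc : 0 < τc)
    (hξ : 0 < ξ) (hunder : 1 / 2 < ω₀ * τc) {k : ℝ} (hk : 0 ≤ k) (τ : ℝ) :
    ∫ w : ℝ, Complex.exp (Complex.I * (w * τ)) * (spectralDensity σ₀ ω₀ τc ξ ε k w : ℂ)
      = residueConst σ₀ ω₀ τc *
        ((decayRate ω₀ τc)⁻¹ * Complex.exp (-(decayRate ω₀ τc * |τ|)) *
            Complex.exp (-(spatialRate ω₀ τc ξ ε τ * k))
          - (conj (decayRate ω₀ τc))⁻¹ * Complex.exp (-(conj (decayRate ω₀ τc) * |τ|)) *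
            Complex.exp (-(conj (spatialRate ω₀ τc ξ ε τ) * k))) := by
  have hB := dispB_pos hξ hk
  have h1 : 0 < (decayRate ω₀ τc * dispB ξ k).re := by
    rw [Complex.re_mul_ofReal]
    exact mul_pos (decayRate_re_pos hτc) hB
  have h2 : 0 < (conj (decayRate ω₀ τc) * dispB ξ k).re := by
    rw [Complex.re_mul_ofReal, Complex.conj_re]
    exact mul_pos (decayRate_re_pos hτc) hB
  have hBc : (dispB ξ k : ℂ) ≠ 0 := by exact_mod_cast hB.ne'
  have hl : decayRate ω₀ τc ≠ 0 := fun h => by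
    have := decayRate_re_pos (ω₀ := ω₀) hτc
    simp [h] at this
  have hl' : conj (decayRate ω₀ τc) ≠ 0 := by simpa using hl
  have hconj : conj (spatialRate ω₀ τc ξ ε τ) = ε + ξ * |τ| * conj (decayRate ω₀ τc) := by
    rw [spatialRate_eq]; simp
  have hfactor : ∀ l : ℂ, (Real.exp (-(ε * k)) : ℂ) * Complex.exp (-(l * dispB ξ k * |τ|))
      = Complex.exp (-(l * |τ|)) * Complex.exp (-((ε + ξ * |τ| * l) * k)) := by
    intro l
    rw [Complex.ofReal_exp, ← Complex.exp_add, ← Complex.exp_add, dispB]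
    congr 1
    push_cast
    ring
  have e : ∀ w : ℝ, Complex.exp (Complex.I * (w * τ)) * (spectralDensity σ₀ ω₀ τc ξ ε k w : ℂ)
      = (σ₀ ^ 2 * Real.exp (-(ε * k)) * dispB ξ k / (2 * Complex.I * omegaD ω₀ τc * τc)) *
        (Complex.exp (Complex.I * (w * τ)) * ((w : ℂ) ^ 2 + (decayRate ω₀ τc * dispB ξ k) ^ 2)⁻¹
          - Complex.exp (Complex.I * (w * τ)) *
            ((w : ℂ) ^ 2 + (conj (decayRate ω₀ τc) * dispB ξ k) ^ 2)⁻¹) := by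
    intro w
    rw [spectralDensity_eq_partialFractions hτc hξ hunder hk]
    ring
  simp_rw [e]
  rw [integral_const_mul, integral_sub (integrable_cexp_mul_inv_sq_add_sq h1 τ)
    (integrable_cexp_mul_inv_sq_add_sq h2 τ), integral_cexp_mul_inv_sq_add_sq h1,
    integral_cexp_mul_inv_sq_add_sq h2, hconj, spatialRate_eq, mul_assoc (decayRate ω₀ τc)⁻¹,
    ← hfactor, mul_assoc (conj (decayRate ω₀ τc))⁻¹, ← hfactor, residueConst]
  field_simp

lemma spectralDensity_nonneg (hξ : 0 < ξ) {k : ℝ} (hk : 0 ≤ k) (w : ℝ) :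
    0 ≤ spectralDensity σ₀ ω₀ τc ξ ε k w := by
  have hB := dispB_pos hξ hk
  unfold spectralDensity dispA
  positivity

lemma integrable_spectralDensity {d : ℕ} (hτc : 0 < τc)
    (hξ : 0 < ξ) (hε : 0 < ε) (hunder : 1 / 2 < ω₀ * τc) :
    Integrable (fun p : EuclideanSpace ℝ (Fin d) × ℝ =>
      spectralDensity σ₀ ω₀ τc ξ ε ‖p.1‖ p.2) := by
  have hm : AEStronglyMeasurable (fun p : EuclideanSpace ℝ (Fin d) × ℝ =>
      spectralDensity σ₀ ω₀ τc ξ ε ‖p.1‖ p.2) (volume.prod volume) := by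
    apply Measurable.aestronglyMeasurable
    unfold spectralDensity dispA dispB
    fun_prop
  rw [Measure.volume_eq_prod, integrable_prod_iff hm]
  refine ⟨Eventually.of_forall fun k => ?_, ?_⟩
  · refine (integrable_cexp_mul_spectralDensity (σ₀ := σ₀) (ε := ε) hτc hξ hunder
      (norm_nonneg k) 0).re.congr (Eventually.of_forall fun w => ?_)
    simp
  -- The density is nonnegative, so that the formula at `τ = 0` gives its `ω`-integral in norm.
  · refine ((integrable_exp_neg_mul_norm volume hε).const_mul ‖residueConst σ₀ ω₀ τc *
      ((decayRate ω₀ τc)⁻¹ - (conj (decayRate ω₀ τc))⁻¹)‖).congr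
      (Eventually.of_forall fun k => ?_)
    have h := integral_cexp_mul_spectralDensity (σ₀ := σ₀) (ε := ε) hτc hξ hunder
      (norm_nonneg k) 0
    have hs : spatialRate ω₀ τc ξ ε 0 = (ε : ℂ) := by rw [spatialRate_eq]; simp
    simp only [Complex.ofReal_zero, mul_zero, Complex.exp_zero, one_mul, abs_zero, neg_zero,
      mul_one, hs, Complex.conj_ofReal, ← sub_mul, ← mul_assoc] at h
    rw [integral_complex_ofReal] at h
    simp only [Real.norm_of_nonneg (spectralDensity_nonneg hξ (norm_nonneg k) _)]
    have h' := congrArg norm h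
    rw [Complex.norm_of_nonneg
      (integral_nonneg fun w => spectralDensity_nonneg hξ (norm_nonneg k) w), norm_mul,
      Complex.norm_exp] at h'
    rw [h']
    simp

end Oscillator

/-! ### The kernel in closed form -/

section Kernel

variable {σ₀ ω₀ τc ξ ε : ℝ}

lemma spatialRate_re_pos (hτc : 0 < τc) (hξ : 0 < ξ) (hε : 0 < ε) (τ : ℝ) :
    0 < (spatialRate ω₀ τc ξ ε τ).re :=
  aRe_pos hτc hξ hε τ

lemma spatialRate_eq_polar (hτc : 0 < τc) (hξ : 0 < ξ) (hε : 0 < ε) (τ : ℝ) :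
    spatialRate ω₀ τc ξ ε τ = Real.sqrt (aRe τc ξ ε τ ^ 2 + aIm ω₀ τc ξ τ ^ 2) *
      Complex.exp (-(phiPhase ω₀ τc ξ ε τ * Complex.I)) := by
  have hR := aRe_pos hτc hξ hε τ
  have hs : Real.sqrt (aRe τc ξ ε τ ^ 2 + aIm ω₀ τc ξ τ ^ 2)
      = aRe τc ξ ε τ * Real.sqrt (1 + (aIm ω₀ τc ξ τ / aRe τc ξ ε τ) ^ 2) := by
    rw [← Real.sqrt_sq hR.le, ← Real.sqrt_mul (sq_nonneg _), Real.sqrt_sq hR.le]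
    congr 1
    field_simp
  have h1 : 0 < Real.sqrt (1 + (aIm ω₀ τc ξ τ / aRe τc ξ ε τ) ^ 2) :=
    Real.sqrt_pos.2 (by positivity)
  rw [← neg_mul, ← Complex.ofReal_neg]
  apply Complex.ext
  · rw [Complex.re_ofReal_mul, Complex.exp_ofReal_mul_I_re, Real.cos_neg, phiPhase,
      Real.cos_arctan, hs, spatialRate]
    field_simp
  · rw [Complex.im_ofReal_mul, Complex.exp_ofReal_mul_I_im, Real.sin_neg, phiPhase,
      Real.sin_arctan, hs, spatialRate]
    field_simp

/-- Polar form of the power in the Poisson kernel. With `a = aRe - i aIm`, the point whose argument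
is `gammaPhase` is the conjugate of `a² + r²`, so that the phase enters with a minus sign. -/
lemma spatialRate_sq_add_sq_cpow (hτc : 0 < τc) (hξ : 0 < ξ) (hε : 0 < ε) (d : ℕ) (r τ : ℝ) :
    (spatialRate ω₀ τc ξ ε τ ^ 2 + (r : ℂ) ^ 2) ^ (((d : ℂ) + 1) / 2)
      = (((aRe τc ξ ε τ ^ 2 + aIm ω₀ τc ξ τ ^ 2 + r ^ 2) ^ 2
          - 4 * aIm ω₀ τc ξ τ ^ 2 * r ^ 2) ^ (((d : ℝ) + 1) / 4) : ℝ) *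
        Complex.exp (-((((d : ℝ) + 1) * gammaPhase ω₀ τc ξ ε r τ / 2 : ℝ) * Complex.I)) := by
  set W : ℂ := ⟨gammaDen ω₀ τc ξ ε r τ, gammaNum ω₀ τc ξ ε τ⟩ with hW
  have hw : spatialRate ω₀ τc ξ ε τ ^ 2 + (r : ℂ) ^ 2 = conj W := by
    apply Complex.ext
    · simp [hW, spatialRate, pow_two, gammaDen]
    · simp [hW, spatialRate, pow_two, gammaNum]; ring
  have hne : conj W ≠ 0 := by
    rw [← hw]
    exact Complex.slitPlane_ne_zero (sq_add_sq_mem_slitPlane (spatialRate_re_pos hτc hξ hε τ) r)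
  have harg : W.arg = gammaPhase ω₀ τc ξ ε r τ := rfl
  have hpi : W.arg ≠ Real.pi := by
    rw [harg]
    exact (gammaPhase_mem_and_tan hτc hξ hε r τ).1.2.ne
  have hnorm : ‖W‖ = Real.sqrt ((aRe τc ξ ε τ ^ 2 + aIm ω₀ τc ξ τ ^ 2 + r ^ 2) ^ 2
      - 4 * aIm ω₀ τc ξ τ ^ 2 * r ^ 2) := by
    rw [Complex.norm_def, Complex.normSq_apply]
    congr 1
    simp only [hW, gammaDen, gammaNum]
    ring
  have hQ : 0 ≤ (aRe τc ξ ε τ ^ 2 + aIm ω₀ τc ξ τ ^ 2 + r ^ 2) ^ 2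
      - 4 * aIm ω₀ τc ξ τ ^ 2 * r ^ 2 := by
    have := Complex.normSq_nonneg W
    rw [Complex.normSq_apply] at this
    simp only [hW, gammaDen, gammaNum] at this
    linarith
  have hexp : ((d : ℂ) + 1) / 2 = ((((d : ℝ) + 1) / 2 : ℝ) : ℂ) := by push_cast; rfl
  have hpow : ‖W‖ ^ (((d : ℝ) + 1) / 2)
      = ((aRe τc ξ ε τ ^ 2 + aIm ω₀ τc ξ τ ^ 2 + r ^ 2) ^ 2
          - 4 * aIm ω₀ τc ξ τ ^ 2 * r ^ 2) ^ (((d : ℝ) + 1) / 4) := by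
    rw [hnorm, Real.sqrt_eq_rpow, ← Real.rpow_mul hQ]
    congr 1
    ring
  rw [hw, hexp, ← hpow, Complex.cpow_ofReal, Complex.norm_conj, Complex.arg_conj, if_neg hpi,
    harg, ← neg_mul, ← Complex.ofReal_neg, Complex.exp_mul_I]
  push_cast
  ring_nf

/-- The right-hand side of the complex Poisson kernel, without the factor `(2π)^d`. -/
lemma gamma_mul_spatialRate_div_cpow (hτc : 0 < τc) (hξ : 0 < ξ) (hε : 0 < ε) (d : ℕ) (r τ : ℝ) :
    ((Real.Gamma (((d : ℝ) + 1) / 2) / Real.pi ^ (((d : ℝ) + 1) / 2) : ℝ) : ℂ) *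
        (spatialRate ω₀ τc ξ ε τ /
          (spatialRate ω₀ τc ξ ε τ ^ 2 + (r : ℂ) ^ 2) ^ (((d : ℂ) + 1) / 2))
      = g0 d ω₀ τc ξ ε r τ * Complex.exp (((((d : ℝ) + 1) * gammaPhase ω₀ τc ξ ε r τ / 2
          - phiPhase ω₀ τc ξ ε τ : ℝ) : ℂ) * Complex.I) := by
  rw [spatialRate_sq_add_sq_cpow hτc hξ hε, g0]
  nth_rewrite 1 [spatialRate_eq_polar hτc hξ hε]
  have : ∀ x y : ℂ, Complex.exp (-(x * Complex.I)) / Complex.exp (-(y * Complex.I))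
      = Complex.exp ((y - x) * Complex.I) := by
    intro x y
    rw [← Complex.exp_sub]
    congr 1
    ring
  rw [mul_div_mul_comm, this, ← Complex.ofReal_div, ← Complex.ofReal_sub,
    ← mul_assoc, ← Complex.ofReal_mul]

/-- The kernel is `σ₀² / (2 τc ω_d ω₀²)` times the imaginary part of
`conj (decayRate) * exp(-decayRate |τ|)` times the Poisson kernel at `spatialRate`. -/
lemma kernel_eq (hτc : 0 < τc) (hξ : 0 < ξ) (hε : 0 < ε)
    (hunder : 1 / 2 < ω₀ * τc) {d : ℕ} (r : EuclideanSpace ℝ (Fin d)) (τ : ℝ) :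
    kernel σ₀ ω₀ τc ξ ε r τ = ((σ₀ ^ 2 / (2 * τc * omegaD ω₀ τc * ω₀ ^ 2) *
      (conj (decayRate ω₀ τc) * Complex.exp (-(decayRate ω₀ τc * |τ|)) *
        (g0 d ω₀ τc ξ ε ‖r‖ τ * Complex.exp (((((d : ℝ) + 1) * gammaPhase ω₀ τc ξ ε ‖r‖ τ / 2
          - phiPhase ω₀ τc ξ ε τ : ℝ) : ℂ) * Complex.I))).im : ℝ) : ℂ) := by
  set G : ℂ := g0 d ω₀ τc ξ ε ‖r‖ τ * Complex.exp (((((d : ℝ) + 1) *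
    gammaPhase ω₀ τc ξ ε ‖r‖ τ / 2 - phiPhase ω₀ τc ξ ε τ : ℝ) : ℂ) * Complex.I) with hG
  set l := decayRate ω₀ τc with hl
  set a := spatialRate ω₀ τc ξ ε τ with ha
  have ha0 : 0 < a.re := spatialRate_re_pos hτc hξ hε τ
  have ha0' : 0 < (conj a).re := by rwa [Complex.conj_re]
  -- The spatial transforms of the two conjugate summands.
  have hP : ∫ k : EuclideanSpace ℝ (Fin d), Complex.exp (Complex.I * (inner ℝ k r : ℝ)) *
      Complex.exp (-(a * ‖k‖)) = (2 * Real.pi) ^ d * G := by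
    rw [integral_cexp_inner_mul_exp_neg_norm ha0, finrank_euclideanSpace_fin, Complex.ofReal_mul,
      mul_assoc, gamma_mul_spatialRate_div_cpow hτc hξ hε, Complex.ofReal_pow]
    push_cast [hG]
    rfl
  have hP' : ∫ k : EuclideanSpace ℝ (Fin d), Complex.exp (Complex.I * (inner ℝ k r : ℝ)) *
      Complex.exp (-(conj a * ‖k‖)) = (2 * Real.pi) ^ d * conj G := by
    have hcpow : (conj a ^ 2 + (‖r‖ : ℂ) ^ 2) ^ (((d : ℂ) + 1) / 2)
        = conj ((a ^ 2 + (‖r‖ : ℂ) ^ 2) ^ (((d : ℂ) + 1) / 2)) := by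
      simpa [Complex.conj_ofNat] using Complex.conj_cpow (a ^ 2 + (‖r‖ : ℂ) ^ 2) (((d : ℂ) + 1) / 2)
        (Complex.mem_slitPlane_iff_arg.1 (sq_add_sq_mem_slitPlane ha0 ‖r‖)).1
    rw [integral_cexp_inner_mul_exp_neg_norm ha0', finrank_euclideanSpace_fin, Complex.ofReal_mul,
      mul_assoc, hG, ← gamma_mul_spatialRate_div_cpow hτc hξ hε, map_mul, Complex.conj_ofReal,
      map_div₀, ← hcpow]
    push_cast
    rfl
  have hint : Integrable fun p : EuclideanSpace ℝ (Fin d) × ℝ =>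
      Complex.exp (Complex.I * ((inner ℝ p.1 r + p.2 * τ : ℝ) : ℂ)) *
        (spectralDensity σ₀ ω₀ τc ξ ε ‖p.1‖ p.2 : ℂ) := by
    refine (integrable_spectralDensity (σ₀ := σ₀) (d := d) hτc hξ hε hunder).ofReal.bdd_mul
      (c := 1) ?_ (Eventually.of_forall fun p => (norm_cexp_I_mul_ofReal _).le)
    apply Continuous.aestronglyMeasurable
    fun_prop
  rw [kernel, inverseFourier]
  rw [Measure.volume_eq_prod] at hint ⊢
  rw [integral_prod _ hint]
  have hinner : ∀ k : EuclideanSpace ℝ (Fin d), ∫ w : ℝ,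
      Complex.exp (Complex.I * ((inner ℝ k r + w * τ : ℝ) : ℂ)) *
        (spectralDensity σ₀ ω₀ τc ξ ε ‖k‖ w : ℂ)
      = residueConst σ₀ ω₀ τc * (l⁻¹ * Complex.exp (-(l * |τ|))) *
          (Complex.exp (Complex.I * (inner ℝ k r : ℝ)) * Complex.exp (-(a * ‖k‖)))
        - residueConst σ₀ ω₀ τc * ((conj l)⁻¹ * Complex.exp (-(conj l * |τ|))) *
          (Complex.exp (Complex.I * (inner ℝ k r : ℝ)) * Complex.exp (-(conj a * ‖k‖))) := by
    intro k
    have hsplit : ∀ w : ℝ, Complex.exp (Complex.I * ((inner ℝ k r + w * τ : ℝ) : ℂ)) *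
        (spectralDensity σ₀ ω₀ τc ξ ε ‖k‖ w : ℂ)
        = Complex.exp (Complex.I * (inner ℝ k r : ℝ)) *
          (Complex.exp (Complex.I * (w * τ)) * (spectralDensity σ₀ ω₀ τc ξ ε ‖k‖ w : ℂ)) := by
      intro w
      rw [← mul_assoc, ← Complex.exp_add]
      congr 2
      push_cast
      ring
    simp_rw [hsplit]
    rw [integral_const_mul,
      integral_cexp_mul_spectralDensity hτc hξ hunder (norm_nonneg k)]
    ring
  simp_rw [hinner]
  rw [integral_sub ((integrable_cexp_inner_mul_exp_neg_norm ha0 r).const_mul _)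
    ((integrable_cexp_inner_mul_exp_neg_norm ha0' r).const_mul _), integral_const_mul,
    integral_const_mul, hP, hP']
  have hq := omegaD_pos hτc hunder
  have hω : ω₀ ≠ 0 := fun h => by rw [h] at hunder; norm_num at hunder
  have hll : l * conj l = (ω₀ : ℂ) ^ 2 := decayRate_mul_conj hτc hunder
  have hl0 : l ≠ 0 := fun h => by
    rw [h, zero_mul] at hll
    exact hω (by simpa using hll.symm)
  have hl0' : conj l ≠ 0 := by simpa using hl0
  have hli : l⁻¹ = conj l / (ω₀ : ℂ) ^ 2 := by rw [← hll]; field_simp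
  have hli' : (conj l)⁻¹ = l / (ω₀ : ℂ) ^ 2 := by rw [← hll]; field_simp
  -- The two summands are conjugate, so that their difference is an imaginary part.
  set Z : ℂ := conj l * Complex.exp (-(l * |τ|)) * G with hZ
  have hZc : conj Z = l * Complex.exp (-(conj l * |τ|)) * conj G := by
    simp [hZ, ← Complex.exp_conj]
  have hsub : l⁻¹ * Complex.exp (-(l * |τ|)) * G
      - (conj l)⁻¹ * Complex.exp (-(conj l * |τ|)) * conj G
      = 2 * Z.im * Complex.I / (ω₀ : ℂ) ^ 2 := by
    have h := Complex.sub_conj Z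
    rw [hZc] at h
    push_cast at h
    rw [hli, hli', ← h, hZ]
    ring
  have hfac : ∀ K x y u v c : ℂ, K * x * (c * u) - K * y * (c * v)
      = K * c * (x * u - y * v) := by intros; ring
  rw [hfac, hsub, residueConst]
  have h1 : (ω₀ : ℂ) ≠ 0 := by exact_mod_cast hω
  have h2 : (τc : ℂ) ≠ 0 := by exact_mod_cast hτc.ne'
  have h3 : (omegaD ω₀ τc : ℂ) ≠ 0 := by exact_mod_cast hq.ne'
  have h4 : (Real.pi : ℂ) ≠ 0 := by exact_mod_cast Real.pi_ne_zero
  have h5 := Complex.I_ne_zero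
  push_cast
  rw [pow_succ]
  field_simp

lemma kernel_eq_F1_add_F2 (hτc : 0 < τc) (hξ : 0 < ξ) (hε : 0 < ε)
    (hunder : 1 / 2 < ω₀ * τc) {d : ℕ} (r : EuclideanSpace ℝ (Fin d)) (τ : ℝ) :
    kernel σ₀ ω₀ τc ξ ε r τ = ((c0 σ₀ ω₀ τc * Real.exp (-(|τ| / (2 * τc))) *
      (F1 d ω₀ τc ξ ε ‖r‖ τ + F2 d ω₀ τc ξ ε ‖r‖ τ) : ℝ) : ℂ) := by
  rw [kernel_eq hτc hξ hε hunder]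
  congr 1
  have hq := omegaD_pos hτc hunder
  have hω : ω₀ ≠ 0 := fun h => by rw [h] at hunder; norm_num at hunder
  have hexp : conj (decayRate ω₀ τc) * Complex.exp (-(decayRate ω₀ τc * |τ|)) *
        (g0 d ω₀ τc ξ ε ‖r‖ τ * Complex.exp (((((d : ℝ) + 1) * gammaPhase ω₀ τc ξ ε ‖r‖ τ / 2
          - phiPhase ω₀ τc ξ ε τ : ℝ) : ℂ) * Complex.I))
      = ((Real.exp (-(|τ| / (2 * τc))) * g0 d ω₀ τc ξ ε ‖r‖ τ : ℝ) : ℂ) *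
        (conj (decayRate ω₀ τc) *
          Complex.exp ((totalPhase d ω₀ τc ξ ε ‖r‖ τ : ℂ) * Complex.I)) := by
    have hl : decayRate ω₀ τc = ((1 / (2 * τc) : ℝ) : ℂ) - omegaD ω₀ τc * Complex.I := by
      apply Complex.ext <;> simp [decayRate]
    have he : Complex.exp (-(decayRate ω₀ τc * |τ|)) *
        Complex.exp (((((d : ℝ) + 1) * gammaPhase ω₀ τc ξ ε ‖r‖ τ / 2
          - phiPhase ω₀ τc ξ ε τ : ℝ) : ℂ) * Complex.I)
        = Real.exp (-(|τ| / (2 * τc))) *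
          Complex.exp ((totalPhase d ω₀ τc ξ ε ‖r‖ τ : ℂ) * Complex.I) := by
      rw [Complex.ofReal_exp, ← Complex.exp_add, ← Complex.exp_add, hl, totalPhase]
      congr 1
      push_cast
      ring
    rw [Complex.ofReal_mul]
    linear_combination (conj (decayRate ω₀ τc) * g0 d ω₀ τc ξ ε ‖r‖ τ) * he
  rw [hexp, Complex.im_ofReal_mul, Complex.mul_im, Complex.exp_ofReal_mul_I_re,
    Complex.exp_ofReal_mul_I_im, Complex.conj_re, Complex.conj_im]
  simp only [decayRate, c0, F1, F2]
  field_simp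
  ring

end Kernel

end LDHO

end

theorem mainTheorem4 (d : ℕ) (σ₀ ω₀ τc ξ ε : ℝ) (hω₀ : 0 < ω₀) (hτc : 0 < τc)
    (hξ : 0 < ξ) (hε : 0 < ε) (hunder : 1 / 2 < ω₀ * τc) :
    -- the spectral density is integrable, so that its inverse Fourier transform exists
    Integrable (fun p : EuclideanSpace ℝ (Fin d) × ℝ =>
      LDHO.spectralDensity σ₀ ω₀ τc ξ ε ‖p.1‖ p.2) ∧
    -- the phase φ is the solution of tan φ = a_Im / a_Re in [0, π/2)
    (∀ τ : ℝ, LDHO.phiPhase ω₀ τc ξ ε τ ∈ Set.Ico 0 (Real.pi / 2) ∧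
      Real.tan (LDHO.phiPhase ω₀ τc ξ ε τ) = LDHO.aIm ω₀ τc ξ τ / LDHO.aRe τc ξ ε τ) ∧
    -- the phase γ is the solution of tan γ = 2 a_Im a_Re / (a_Re² - a_Im² + r²) in [0, π)
    (∀ r τ : ℝ, LDHO.gammaPhase ω₀ τc ξ ε r τ ∈ Set.Ico 0 Real.pi ∧
      (LDHO.gammaDen ω₀ τc ξ ε r τ ≠ 0 →
        Real.tan (LDHO.gammaPhase ω₀ τc ξ ε r τ) =
          LDHO.gammaNum ω₀ τc ξ ε τ / LDHO.gammaDen ω₀ τc ξ ε r τ) ∧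
      (LDHO.gammaDen ω₀ τc ξ ε r τ = 0 → LDHO.gammaPhase ω₀ τc ξ ε r τ = Real.pi / 2)) ∧
    -- the formula for the kernel
    (∀ (r : EuclideanSpace ℝ (Fin d)) (τ : ℝ),
      LDHO.kernel σ₀ ω₀ τc ξ ε r τ =
        ((LDHO.c0 σ₀ ω₀ τc * Real.exp (-(|τ| / (2 * τc))) *
          (LDHO.F1 d ω₀ τc ξ ε ‖r‖ τ + LDHO.F2 d ω₀ τc ξ ε ‖r‖ τ) : ℝ) : ℂ)) := by
  refine ⟨LDHO.integrable_spectralDensity hτc hξ hε hunder,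
    fun τ => LDHO.phiPhase_mem_and_tan hτc hξ hε τ,
    fun r τ => LDHO.gammaPhase_mem_and_tan hτc hξ hε r τ,
    fun r τ => LDHO.kernel_eq_F1_add_F2 hτc hξ hε hunder r τ⟩
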